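/- There is an absolute constant $c>0$ with the following property. Let $D\ge 2$, $M,N\ge 0$ be integers and let $\epsilon,B$ be real numbers with $0<\epsilon\le 1/6$ and $36\epsilon^2\le B\le D$. Let $F^{(1)},\dots,F^{(N)}$ be a fixed sequence of $D$-dimensional POVMs, where each $F^{(k)}=(F^{(k)}_1,\dots,F^{(k)}_{l_k})$ consists of finitely many positive semidefinite $D\times D$ matrices that sum to the identity. If the $F^{(k)}$ are applied to $N$ independent copies of a state $\rho$, one copy each, the outcome string $(y_1,\dots,y_N)$ has probability $\prod_{k=1}^N\mathrm{tr}(F^{(k)}_{y_k}\rho)$. Suppose that for any $M$ Hermitian $D\times D$ matrices $O_1,\dots,O_M$ with $0\preceq O_i\preceq I$ and $\max_i\|O_i\|_2^2\le B$ (where $\|O\|_2^2=\mathrm{tr}(O^\dagger O)$) there is a machine, that is, an arbitrary, possibly randomized, map from outcome strings to vectors $(\hat o_1,\dots,\hat o_M)\in\mathbb{R}^M$, such that for every density matrix $\rho$ on $\mathbb{C}^D$, with probability at least $2/3$ over the measurement outcomes and the randomness of the machine, $$|\hat o_i-\mathrm{tr}(O_i\rho)|\le\epsilon\quad\text{for all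 } 1\le i\le M.$$ Then $$N\ \ge\ c\,\min\left(\frac{B\log M}{\epsilon^2},\ \frac{B^2D}{\epsilon^4},\ \frac{BD^2}{\epsilon^2}\right)$$ (with the convention $\log 0=0$). -/

import Mathlib

open scoped ComplexOrder

/-- A `D`-dimensional POVM with `l` possible outcomes: positive semidefinite `D × D` matrices
that sum up to the identity. -/
structure POVM (D l : ℕ) where
  effect : Fin l → Matrix (Fin D) (Fin D) ℂ
  posSemidef : ∀ j, (effect j).PosSemidef
  sum_eq_one : ∑ j, effect j = 1

/-- A `D`-dimensional quantum state (density matrix). -/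
def IsDensityMatrix {D : ℕ} (ρ : Matrix (Fin D) (Fin D) ℂ) : Prop :=
  ρ.PosSemidef ∧ ρ.trace = 1

/-- The value `tr (A ρ)`; it is a real number for Hermitian `A` and `ρ`. -/
noncomputable def expVal {D : ℕ} (A ρ : Matrix (Fin D) (Fin D) ℂ) : ℝ :=
  (A * ρ).trace.re

/-- The squared Hilbert-Schmidt norm `tr (Oᴴ O)`. -/
noncomputable def hsNormSq {D : ℕ} (O : Matrix (Fin D) (Fin D) ℂ) : ℝ :=
  (O.conjTranspose * O).trace.re

/-- A feature `0 ≤ O ≤ I` (in the positive semidefinite order) with `‖O‖₂² ≤ B`. -/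
def IsFeature {D : ℕ} (B : ℝ) (O : Matrix (Fin D) (Fin D) ℂ) : Prop :=
  O.PosSemidef ∧ (1 - O).PosSemidef ∧ hsNormSq O ≤ B

/-- Born's rule for single-copy measurements: the probability of the outcome string `y` when
`F 0, …, F (N - 1)` are performed on `N` independent copies of `ρ`, one copy each. -/
noncomputable def outcomeProb {D N : ℕ} {l : Fin N → ℕ} (F : ∀ k, POVM D (l k))
    (ρ : Matrix (Fin D) (Fin D) ℂ) (y : ∀ k, Fin (l k)) : ℝ :=
  ∏ k, expVal ((F k).effect (y k)) ρ

/-- A (possibly randomized) prediction machine: it receives a string of measurement outcomes and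
outputs a random vector of `M` real numbers, the predictions. -/
abbrev PredictionMachine {N : ℕ} (l : Fin N → ℕ) (M : ℕ) :=
  (∀ k, Fin (l k)) → MeasureTheory.ProbabilityMeasure (Fin M → ℝ)

/-- The probability, over the measurement outcomes and the internal randomness of the machine,
that all `M` predictions are `ε`-accurate when the unknown state is `ρ`. -/
noncomputable def successProb {D N M : ℕ} {l : Fin N → ℕ} (F : ∀ k, POVM D (l k))
    (A : PredictionMachine l M) (O : Fin M → Matrix (Fin D) (Fin D) ℂ) (ε : ℝ)
    (ρ : Matrix (Fin D) (Fin D) ℂ) : ℝ :=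
  ∑ y, outcomeProb F ρ y *
    (A y : MeasureTheory.Measure (Fin M → ℝ)).real {o | ∀ i, |o i - expVal (O i) ρ| ≤ ε}

/-- The fixed measurements `F` allow for feature prediction: for any `M` features there is a
machine that, for every unknown state, predicts all of them up to `ε` with probability at
least `p`. -/
def AllowsPrediction {D N : ℕ} {l : Fin N → ℕ} (F : ∀ k, POVM D (l k))
    (M : ℕ) (B ε p : ℝ) : Prop :=
  ∀ O : Fin M → Matrix (Fin D) (Fin D) ℂ, (∀ i, IsFeature B (O i)) →
    ∃ A : PredictionMachine l M,
      ∀ ρ : Matrix (Fin D) (Fin D) ℂ, IsDensityMatrix ρ → p ≤ successProb F A O ε ρ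

/-! The features may be chosen after the measurements. So it suffices to find, for fixed
measurements, many states whose outcome statistics stay close to those of the maximally mixed state,
but which suitable features tell apart. A `D × r` sign matrix `G` gives the state `(1 - η) I / D + η
G Gᵀ / (D r)` and the feature `δ Π`, where `Π = U Uᵀ` projects onto the column space of `G`. This
feature is larger on its own state than on the state of `G'` by `δ η (1 - ‖Uᵀ G'‖² / (D r))`. If the
overlap `‖Uᵀ G'‖²` is at most half of its maximum `D r`, the choice `η δ = 5 ε` makes the gap exceed
`2 ε`.

Two averages over random signs carry the proof. The mean `χ²`-divergence of one measurement is at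
most `2 η² / r` (`sum_chiSq_signState_le`), and only a fraction `exp (-D r / 16)` of the sign
matrices has a large overlap with a given one (`card_overlap_gt_le`). Markov's inequality keeps half
of the matrices, and a greedy choice among them gives up to `exp (D r / 32)` separated states.
Accurate predictions identify the state, which forces `log M ≤ 36 X`, with `X` a bound on the total
divergence (`log_le_of_identification`). Since `δ² r` is of order `B`, each copy contributes order
`ε² / B`, whence `N ≳ B log M / ε²`.

The packing limits `log M` to order `D r`, while `8 r ≤ D` and `η ≤ 1` limit `r` to order `min (D, B
/ ε²)`. Truncating `M` accordingly produces the other two terms of the minimum. For `D < 64`, two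
features with `r = 1` suffice. -/

open MeasureTheory ProbabilityTheory

/-! ### Moments and exponential moments of independent random signs. -/

section Signs

/-- The real value of the `x`-th sign. -/
def sgn {ι : Type*} (g : ι → ℤˣ) (x : ι) : ℝ := ((g x : ℤ) : ℝ)

lemma sgn_mul_self {ι : Type*} (g : ι → ℤˣ) (x : ι) : sgn g x * sgn g x = 1 := by
  unfold sgn
  rcases Int.units_eq_one_or (g x) with h | h <;> simp [h]

lemma sgn_flip {ι : Type*} [DecidableEq ι] (g : ι → ℤˣ) (a x : ι) :
    sgn (Function.update g a (-(g a))) x = if x = a then -sgn g x else sgn g x := by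
  unfold sgn
  by_cases h : x = a
  · subst h; simp
  · simp [h]

variable {ι κ : Type*} [Fintype ι] [DecidableEq ι] [Fintype κ]

lemma sum_signs_eq_zero_of_flip (φ : (ι → ℤˣ) → ℝ) (a : ι)
    (h : ∀ g, φ (Function.update g a (-(g a))) = -φ g) : ∑ g, φ g = 0 := by
  have hinv : Function.Involutive (fun g : ι → ℤˣ => Function.update g a (-(g a))) := by
    intro g; simp
  have : ∑ g, φ g = ∑ g, φ (Function.update g a (-(g a))) :=
    (Equiv.sum_comp hinv.toPerm φ).symm
  simp_rw [h, Finset.sum_neg_distrib] at this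
  linarith

lemma sum_sgn_mul_sgn (x y : ι) :
    ∑ g : ι → ℤˣ, sgn g x * sgn g y = if x = y then 2 ^ Fintype.card ι else 0 := by
  split_ifs with h
  · subst h; simp [sgn_mul_self]
  · refine sum_signs_eq_zero_of_flip _ x fun g => ?_
    simp [sgn_flip, Ne.symm h]

/-- Flipping a sign that occurs an odd number of times negates the summand, so only the two pairings
across the products survive. -/
lemma sum_sgn_four {x y z w : ι} (hxy : x ≠ y) (hzw : z ≠ w) :
    ∑ g : ι → ℤˣ, (sgn g x * sgn g y) * (sgn g z * sgn g w) =
      (if x = z ∧ y = w then 2 ^ Fintype.card ι else 0) +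
      (if x = w ∧ y = z then 2 ^ Fintype.card ι else 0) := by
  by_cases h1 : x = z
  · subst h1
    have e : ∀ g : ι → ℤˣ,
        (sgn g x * sgn g y) * (sgn g x * sgn g w) = sgn g y * sgn g w := fun g => by
      linear_combination (sgn g y * sgn g w) * sgn_mul_self g x
    simp [e, sum_sgn_mul_sgn, hzw]
  by_cases h2 : x = w
  · subst h2
    have e : ∀ g : ι → ℤˣ,
        (sgn g x * sgn g y) * (sgn g z * sgn g x) = sgn g y * sgn g z := fun g => by
      linear_combination (sgn g y * sgn g z) * sgn_mul_self g x
    simp [e, sum_sgn_mul_sgn, h1]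
  · simp only [h1, h2, false_and, if_false, add_zero]
    refine sum_signs_eq_zero_of_flip _ x fun g => ?_
    simp [sgn_flip, Ne.symm hxy, Ne.symm h1, Ne.symm h2]

/-- Second moment of an off-diagonal quadratic form in independent signs. -/
lemma sum_sq_quadratic_signs (a : ι → ι → ℝ) (hs : ∀ x y, a x y = a y x) (hd : ∀ x, a x x = 0) :
    ∑ g : ι → ℤˣ, (∑ x, ∑ y, a x y * (sgn g x * sgn g y)) ^ 2 =
      2 ^ Fintype.card ι * (2 * ∑ x, ∑ y, a x y ^ 2) := by
  have key : ∀ x y z w, a x y * a z w *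
      ∑ g : ι → ℤˣ, (sgn g x * sgn g y) * (sgn g z * sgn g w) =
      a x y * a z w * ((if x = z then if y = w then (2 : ℝ) ^ Fintype.card ι else 0 else 0) +
        (if x = w then if y = z then (2 : ℝ) ^ Fintype.card ι else 0 else 0)) := by
    intro x y z w
    by_cases hxy : x = y
    · simp [hxy, hd]
    by_cases hzw : z = w
    · simp [hzw, hd]
    rw [sum_sgn_four hxy hzw]
    simp only [ite_and]
  have e1 : ∀ g : ι → ℤˣ, (∑ x, ∑ y, a x y * (sgn g x * sgn g y)) ^ 2 =
      ∑ x, ∑ y, ∑ z, ∑ w, a x y * a z w * ((sgn g x * sgn g y) * (sgn g z * sgn g w)) := by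
    intro g
    rw [sq, Finset.sum_mul]
    refine Finset.sum_congr rfl fun x _ => ?_
    rw [Finset.sum_mul]
    refine Finset.sum_congr rfl fun y _ => ?_
    rw [Finset.mul_sum]
    refine Finset.sum_congr rfl fun z _ => ?_
    rw [Finset.mul_sum]
    exact Finset.sum_congr rfl fun w _ => by ring
  calc _ = ∑ x, ∑ y, ∑ z, ∑ w, a x y * a z w *
        ∑ g : ι → ℤˣ, (sgn g x * sgn g y) * (sgn g z * sgn g w) := by
        simp_rw [e1, Finset.mul_sum]
        rw [Finset.sum_comm]
        refine Finset.sum_congr rfl fun x _ => ?_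
        rw [Finset.sum_comm]
        refine Finset.sum_congr rfl fun y _ => ?_
        rw [Finset.sum_comm]
        refine Finset.sum_congr rfl fun z _ => ?_
        rw [Finset.sum_comm]
    _ = ∑ x, ∑ y, 2 ^ Fintype.card ι * (2 * a x y ^ 2) := by
        refine Finset.sum_congr rfl fun x _ => Finset.sum_congr rfl fun y _ => ?_
        simp_rw [key, mul_add, Finset.sum_add_distrib]
        have h1 : ∑ z, ∑ w, a x y * a z w *
            (if x = z then if y = w then (2 : ℝ) ^ Fintype.card ι else 0 else 0) =
            a x y * a x y * 2 ^ Fintype.card ι := by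
          rw [Finset.sum_eq_single x, Finset.sum_eq_single y] <;> simp +contextual [eq_comm]
        have h2 : ∑ z, ∑ w, a x y * a z w *
            (if x = w then if y = z then (2 : ℝ) ^ Fintype.card ι else 0 else 0) =
            a x y * a y x * 2 ^ Fintype.card ι := by
          rw [Finset.sum_eq_single y, Finset.sum_eq_single x] <;> simp +contextual [eq_comm]
        rw [h1, h2, hs y x]; ring
    _ = _ := by simp_rw [Finset.mul_sum]

/-- The sum factorizes into terms `2 cosh (c x)`, and `cosh u ≤ exp (u² / 2)`. -/
lemma sum_signs_exp_le (c : ι → ℝ) :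
    ∑ g : ι → ℤˣ, Real.exp (∑ x, sgn g x * c x) ≤
      2 ^ Fintype.card ι * Real.exp ((∑ x, c x ^ 2) / 2) := by
  have h : ∑ g : ι → ℤˣ, Real.exp (∑ x, sgn g x * c x) = ∏ x, (2 * Real.cosh (c x)) := by
    have : ∀ x, 2 * Real.cosh (c x) = ∑ s : ℤˣ, Real.exp (((s : ℤ) : ℝ) * c x) := by
      intro x
      rw [UnitsInt.univ, Finset.sum_pair (by decide), Real.cosh_eq]
      simp; ring
    simp_rw [this, Finset.prod_univ_sum, Real.exp_sum, Fintype.piFinset_univ]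
    rfl
  rw [h, Finset.prod_mul_distrib, Finset.sum_div, Real.exp_sum]
  simp only [Finset.prod_const, Finset.card_univ]
  gcongr with x
  exact Real.cosh_le_exp_half_sq _

lemma integral_exp_sq_gaussian :
    ∫ z, Real.exp (z ^ 2 / 4) ∂(gaussianReal 0 1) = √2 := by
  rw [integral_gaussianReal_eq_integral_smul (by simp)]
  have : ∀ x : ℝ, gaussianPDFReal 0 1 x • Real.exp (x ^ 2 / 4) =
      (√(2 * Real.pi))⁻¹ * Real.exp (-(1 / 4) * x ^ 2) := by
    intro x
    simp only [gaussianPDFReal, smul_eq_mul, mul_assoc, ← Real.exp_add]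
    norm_num
    left; ring
  simp_rw [this]
  rw [integral_const_mul, integral_gaussian, ← Real.sqrt_inv, ← Real.sqrt_mul (by positivity)]
  congr 1
  have := Real.pi_pos
  field_simp
  norm_num

lemma integrable_exp_sq_gaussian :
    Integrable (fun z : ℝ => Real.exp (z ^ 2 / 4)) (gaussianReal 0 1) := by
  by_contra h
  have := integral_exp_sq_gaussian
  rw [integral_undef h] at this
  have h2 : (0 : ℝ) < √2 := by positivity
  linarith

/-- Exponential moment of the squared norm of an at most isometric image of a sign vector, obtained
by linearizing the square with a Gaussian. -/
lemma sum_signs_exp_sq_le (c : κ → ι → ℝ)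
    (hc : ∀ z : κ → ℝ, ∑ x, (∑ m, z m * c m x) ^ 2 ≤ ∑ m, z m ^ 2) :
    ∑ g : ι → ℤˣ, Real.exp ((∑ m, (∑ x, c m x * sgn g x) ^ 2) / 4) ≤
      2 ^ Fintype.card ι * √2 ^ Fintype.card κ := by
  set μ : Measure (κ → ℝ) := Measure.pi fun _ => gaussianReal 0 1
  -- With `t² = 1 / 2`, averaging `exp (t v z)` over a standard Gaussian `z` gives `exp (v² / 4)`.
  -- The sign average later returns `exp (z² / 4)`, which is still Gaussian-integrable.
  set t : ℝ := √(1 / 2)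
  have ht : t ^ 2 = 1 / 2 := Real.sq_sqrt (by norm_num)
  have lin : ∀ v : κ → ℝ, Integrable (fun z => Real.exp (∑ m, t * v m * z m)) μ ∧
      ∫ z, Real.exp (∑ m, t * v m * z m) ∂μ = Real.exp ((∑ m, v m ^ 2) / 4) := by
    intro v
    simp_rw [Real.exp_sum]
    constructor
    · exact Integrable.fintype_prod (f := fun m z => Real.exp (t * v m * z))
        fun m => integrable_exp_mul_gaussianReal _
    · rw [integral_fintype_prod_eq_prod (f := fun m z => Real.exp (t * v m * z)),
        Finset.sum_div, Real.exp_sum]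
      refine Finset.prod_congr rfl fun m _ => ?_
      have := congrFun (mgf_id_gaussianReal (μ := 0) (v := 1)) (t * v m)
      simp only [mgf, id] at this
      rw [this]
      congr 1
      simp [mul_pow, ht]; ring
  have quad : Integrable (fun z : κ → ℝ => Real.exp ((∑ m, z m ^ 2) / 4)) μ ∧
      ∫ z, Real.exp ((∑ m, z m ^ 2) / 4) ∂μ = √2 ^ Fintype.card κ := by
    simp_rw [Finset.sum_div, Real.exp_sum]
    constructor
    · exact Integrable.fintype_prod (f := fun (m : κ) z => Real.exp (z ^ 2 / 4))
        fun m => integrable_exp_sq_gaussian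
    · rw [integral_fintype_prod_eq_prod (f := fun (m : κ) z => Real.exp (z ^ 2 / 4))]
      simp [integral_exp_sq_gaussian]
  calc _ = ∑ g : ι → ℤˣ, ∫ z, Real.exp (∑ m, t * (∑ x, c m x * sgn g x) * z m) ∂μ := by
        simp_rw [(lin _).2]
    _ = ∫ z, ∑ g : ι → ℤˣ, Real.exp (∑ m, t * (∑ x, c m x * sgn g x) * z m) ∂μ :=
        (integral_finsetSum _ fun g _ => (lin _).1).symm
    _ ≤ ∫ z, 2 ^ Fintype.card ι * Real.exp ((∑ m, z m ^ 2) / 4) ∂μ := by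
        refine integral_mono (integrable_finsetSum _ fun g _ => (lin _).1)
          (quad.1.const_mul _) fun z => ?_
        have e : ∀ g : ι → ℤˣ, ∑ m, t * (∑ x, c m x * sgn g x) * z m =
            ∑ x, sgn g x * (t * ∑ m, z m * c m x) := by
          intro g
          simp_rw [Finset.mul_sum, Finset.sum_mul]
          rw [Finset.sum_comm]
          exact Finset.sum_congr rfl fun x _ => Finset.sum_congr rfl fun m _ => by ring
        simp only [e]
        refine (sum_signs_exp_le _).trans ?_
        have := hc z
        simp_rw [mul_pow, ht, ← Finset.mul_sum]
        exact mul_le_mul_of_nonneg_left (Real.exp_le_exp.2 (by linarith)) (by positivity)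
    _ = _ := by rw [integral_const_mul, quad.2]

lemma sum_signs_sq_norm (c : κ → ι → ℝ) :
    ∑ g : ι → ℤˣ, ∑ m, (∑ x, c m x * sgn g x) ^ 2 =
      2 ^ Fintype.card ι * ∑ m, ∑ x, c m x ^ 2 := by
  rw [Finset.sum_comm, Finset.mul_sum]
  refine Finset.sum_congr rfl fun m _ => ?_
  have : ∀ g : ι → ℤˣ, (∑ x, c m x * sgn g x) ^ 2 =
      ∑ x, ∑ y, c m x * c m y * (sgn g x * sgn g y) := by
    intro g
    rw [sq, Finset.sum_mul_sum]
    exact Finset.sum_congr rfl fun x _ => Finset.sum_congr rfl fun y _ => by ring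
  simp_rw [this]
  rw [Finset.sum_comm, Finset.mul_sum]
  refine Finset.sum_congr rfl fun x _ => ?_
  rw [Finset.sum_comm]
  simp_rw [← Finset.mul_sum, sum_sgn_mul_sgn]
  simp; ring

end Signs

/-! ### Random states, projection features and their overlaps. -/

section Matrices

variable {D r s : ℕ}

/-- The `D × r` matrix of the signs `g`. -/
def signMatrix (g : Fin D × Fin r → ℤˣ) : Matrix (Fin D) (Fin r) ℝ :=
  Matrix.of fun i k => sgn g (i, k)

/-- The mixture, with weight `η`, of the maximally mixed state and the normalized square of a
sign matrix. -/
noncomputable def signState (η : ℝ) (g : Fin D × Fin r → ℤˣ) : Matrix (Fin D) (Fin D) ℝ :=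
  ((1 - η) / D) • (1 : Matrix (Fin D) (Fin D) ℝ) +
    (η / (D * r)) • (signMatrix g * (signMatrix g).transpose)

/-- The complex matrix with the entries of a real matrix. -/
def toComplex {m n : Type*} (X : Matrix m n ℝ) : Matrix m n ℂ := X.map Complex.ofRealHom

lemma posSemidef_toComplex_mul_transpose (X : Matrix (Fin D) (Fin s) ℝ) :
    (toComplex (X * X.transpose)).PosSemidef := by
  have : toComplex (X * X.transpose) = toComplex X * (toComplex X).conjTranspose := by
    ext i j
    simp [toComplex, Matrix.mul_apply]
  rw [this]
  exact Matrix.posSemidef_self_mul_conjTranspose _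

lemma posSemidef_toComplex_smul {X : Matrix (Fin D) (Fin D) ℝ} (hX : (toComplex X).PosSemidef)
    {a : ℝ} (ha : 0 ≤ a) : (toComplex (a • X)).PosSemidef := by
  have : toComplex (a • X) = a • toComplex X := by
    ext i j
    simp [toComplex]
  rw [this]
  exact hX.smul ha

lemma toComplex_add (X Y : Matrix (Fin D) (Fin D) ℝ) :
    toComplex (X + Y) = toComplex X + toComplex Y := by
  ext i j
  simp [toComplex]

lemma toComplex_one : toComplex (1 : Matrix (Fin D) (Fin D) ℝ) = 1 := by
  simp [toComplex]

lemma trace_toComplex (X : Matrix (Fin D) (Fin D) ℝ) :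
    (toComplex X).trace = (X.trace : ℂ) := by
  simp [toComplex, Matrix.trace]

lemma trace_signMatrix_mul_transpose (g : Fin D × Fin r → ℤˣ) :
    (signMatrix g * (signMatrix g).transpose).trace = D * r := by
  simp [Matrix.trace, Matrix.mul_apply, signMatrix, sgn_mul_self]

lemma isDensityMatrix_signState (hD : 0 < D) (hr : 0 < r) {η : ℝ} (h0 : 0 ≤ η) (h1 : η ≤ 1)
    (g : Fin D × Fin r → ℤˣ) : IsDensityMatrix (toComplex (signState η g)) := by
  have hD' : (0 : ℝ) < D := by exact_mod_cast hD
  have hr' : (0 : ℝ) < r := by exact_mod_cast hr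
  constructor
  · rw [signState, toComplex_add]
    refine Matrix.PosSemidef.add (posSemidef_toComplex_smul ?_ ?_) (posSemidef_toComplex_smul
      (posSemidef_toComplex_mul_transpose _) (by positivity))
    · rw [toComplex_one]; exact Matrix.PosSemidef.one
    · exact div_nonneg (by linarith) hD'.le
  · rw [trace_toComplex, signState, Matrix.trace_add, Matrix.trace_smul, Matrix.trace_smul,
      trace_signMatrix_mul_transpose]
    rw [← Complex.ofReal_one]
    congr 1
    simp
    field_simp
    ring

lemma expVal_toComplex (E : Matrix (Fin D) (Fin D) ℂ) (X : Matrix (Fin D) (Fin D) ℝ) :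
    expVal E (toComplex X) = ∑ i, ∑ j, (E i j).re * X j i := by
  simp [expVal, toComplex, Matrix.trace, Matrix.mul_apply]

lemma expVal_toComplex_toComplex (X Y : Matrix (Fin D) (Fin D) ℝ) :
    expVal (toComplex X) (toComplex Y) = (X * Y).trace := by
  rw [expVal_toComplex]
  simp [toComplex, Matrix.trace, Matrix.mul_apply]

/-- An orthonormal basis of the column space of a real matrix. -/
lemma exists_orthonormal_columns (G : Matrix (Fin D) (Fin r) ℝ) :
    ∃ s ≤ r, ∃ U : Matrix (Fin D) (Fin s) ℝ,
      U.transpose * U = 1 ∧ U * U.transpose * G = G := by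
  set v : Fin r → EuclideanSpace ℝ (Fin D) := fun k => WithLp.toLp 2 fun i => G i k with hv
  obtain ⟨s, hs, w, hw, hrep⟩ : ∃ s ≤ r, ∃ w : Fin s → EuclideanSpace ℝ (Fin D),
      Orthonormal ℝ w ∧ ∀ k, ∑ m, inner ℝ (w m) (v k) • w m = v k := by
    have b := stdOrthonormalBasis ℝ (Submodule.span ℝ (Set.range v))
    refine ⟨_, (finrank_range_le_card (R := ℝ) v).trans_eq (Fintype.card_fin r),
      fun m => (b m : EuclideanSpace ℝ (Fin D)),
      b.orthonormal.comp_linearIsometry (Submodule.subtypeₗᵢ _), fun k => ?_⟩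
    have := congrArg Subtype.val (b.sum_repr' ⟨v k, Submodule.subset_span ⟨k, rfl⟩⟩)
    rw [Submodule.coe_sum] at this
    exact this
  refine ⟨s, hs, Matrix.of fun i m => w m i, ?_, ?_⟩
  · ext m n
    have := orthonormal_iff_ite.1 hw m n
    rw [PiLp.inner_apply] at this
    simp only [Matrix.mul_apply, Matrix.transpose_apply, Matrix.of_apply, Matrix.one_apply, ← this]
    exact Finset.sum_congr rfl fun i _ => mul_comm _ _
  · ext i k
    have := congrArg (fun u : EuclideanSpace ℝ (Fin D) => u i) (hrep k)
    simp only [PiLp.inner_apply, WithLp.ofLp_sum, Finset.sum_apply, PiLp.smul_apply, hv,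
      smul_eq_mul] at this
    rw [Matrix.mul_assoc]
    simp only [Matrix.mul_apply, Matrix.transpose_apply, Matrix.of_apply]
    rw [← this]
    refine Finset.sum_congr rfl fun m _ => ?_
    rw [mul_comm]
    congr 1
    exact Finset.sum_congr rfl fun i _ => mul_comm _ _

/-- The feature `δ Π`, where `Π` is the projection onto the span of the columns of `U`. -/
noncomputable def projFeature (δ : ℝ) (U : Matrix (Fin D) (Fin s) ℝ) :
    Matrix (Fin D) (Fin D) ℝ :=
  δ • (U * U.transpose)

lemma isFeature_projFeature {U : Matrix (Fin D) (Fin s) ℝ} (hU : U.transpose * U = 1)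
    {δ B : ℝ} (h0 : 0 ≤ δ) (h1 : δ ≤ 1) (hB : δ ^ 2 * s ≤ B) :
    IsFeature B (toComplex (projFeature δ U)) := by
  have hP : (U * U.transpose) * (U * U.transpose) = U * U.transpose := by
    rw [Matrix.mul_assoc, ← Matrix.mul_assoc U.transpose, hU, Matrix.one_mul]
  have htr : (U * U.transpose).trace = s := by
    rw [Matrix.trace_mul_comm, hU]; simp
  refine ⟨posSemidef_toComplex_smul (posSemidef_toComplex_mul_transpose _) h0, ?_, ?_⟩
  · have h2 : (1 - U * U.transpose) * (1 - U * U.transpose).transpose = 1 - U * U.transpose := by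
      simp only [Matrix.transpose_sub, Matrix.transpose_one, Matrix.transpose_mul,
        Matrix.transpose_transpose]
      rw [Matrix.mul_sub, Matrix.sub_mul, Matrix.sub_mul, hP]
      simp
    -- `I - δ Π = (1 - δ) I + δ (I - Π)` is a sum of positive semidefinite matrices.
    have h3 : 1 - toComplex (projFeature δ U) =
        toComplex ((1 - δ) • (1 : Matrix (Fin D) (Fin D) ℝ)) +
          toComplex (δ • ((1 - U * U.transpose) * (1 - U * U.transpose).transpose)) := by
      rw [h2, ← toComplex_add, ← toComplex_one, projFeature]
      ext i j
      simp only [toComplex, Matrix.sub_apply, Matrix.add_apply, Matrix.smul_apply,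
        Matrix.map_apply, smul_eq_mul, Complex.ofRealHom_eq_coe]
      push_cast
      ring
    rw [h3]
    refine Matrix.PosSemidef.add (posSemidef_toComplex_smul ?_ (by linarith))
      (posSemidef_toComplex_smul (posSemidef_toComplex_mul_transpose _) h0)
    rw [toComplex_one]; exact Matrix.PosSemidef.one
  · have h4 : (toComplex (projFeature δ U)).conjTranspose = toComplex (projFeature δ U) :=
      (posSemidef_toComplex_smul (posSemidef_toComplex_mul_transpose _) h0).1
    have h5 := expVal_toComplex_toComplex (projFeature δ U) (projFeature δ U)
    rw [expVal] at h5
    rw [hsNormSq, h4, h5, projFeature, Matrix.smul_mul, Matrix.mul_smul, hP, smul_smul,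
      Matrix.trace_smul, htr, smul_eq_mul, ← sq]
    exact hB

/-- The coefficients of the linear forms `g ↦ (Uᵀ G)ₘₖ`. -/
def overlapCoeff (U : Matrix (Fin D) (Fin s) ℝ) (p : Fin s × Fin r) (x : Fin D × Fin r) : ℝ :=
  if x.2 = p.2 then U x.1 p.1 else 0

/-- The squared Hilbert-Schmidt norm of `Uᵀ G`. -/
def overlap (U : Matrix (Fin D) (Fin s) ℝ) (g : Fin D × Fin r → ℤˣ) : ℝ :=
  ∑ p : Fin s × Fin r, (∑ x, overlapCoeff U p x * sgn g x) ^ 2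

lemma sum_overlapCoeff (U : Matrix (Fin D) (Fin s) ℝ) (g : Fin D × Fin r → ℤˣ) (m : Fin s)
    (k : Fin r) : ∑ x, overlapCoeff U (m, k) x * sgn g x = ∑ i, U i m * sgn g (i, k) := by
  rw [Fintype.sum_prod_type]
  simp [overlapCoeff]

lemma trace_proj_mul_signMatrix (U : Matrix (Fin D) (Fin s) ℝ) (g : Fin D × Fin r → ℤˣ) :
    (U * U.transpose * (signMatrix g * (signMatrix g).transpose)).trace = overlap U g := by
  have : (U * U.transpose * (signMatrix g * (signMatrix g).transpose)).trace =
      ((U.transpose * signMatrix g) * (U.transpose * signMatrix g).transpose).trace := by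
    rw [Matrix.mul_assoc, Matrix.trace_mul_comm, Matrix.transpose_mul, Matrix.transpose_transpose]
    simp only [Matrix.mul_assoc]
  rw [this, overlap, Fintype.sum_prod_type]
  simp_rw [sum_overlapCoeff]
  simp only [Matrix.trace, Matrix.diag_apply, Matrix.mul_apply, signMatrix, sq,
    Matrix.transpose_apply, Matrix.of_apply]

lemma overlap_self {U : Matrix (Fin D) (Fin s) ℝ} {g : Fin D × Fin r → ℤˣ}
    (hU : U * U.transpose * signMatrix g = signMatrix g) : overlap U g = D * r := by
  rw [← trace_proj_mul_signMatrix, ← Matrix.mul_assoc, hU, trace_signMatrix_mul_transpose]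

lemma expVal_projFeature_signState {U : Matrix (Fin D) (Fin s) ℝ} (hU : U.transpose * U = 1)
    (δ η : ℝ) (g : Fin D × Fin r → ℤˣ) :
    expVal (toComplex (projFeature δ U)) (toComplex (signState η g)) =
      δ * ((1 - η) / D * s + η / (D * r) * overlap U g) := by
  have htr : (U * U.transpose).trace = s := by
    rw [Matrix.trace_mul_comm, hU]; simp
  rw [expVal_toComplex_toComplex, projFeature, signState, Matrix.smul_mul, Matrix.mul_add,
    Matrix.mul_smul, Matrix.mul_smul, Matrix.mul_one, Matrix.trace_smul, Matrix.trace_add,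
    Matrix.trace_smul, Matrix.trace_smul, trace_proj_mul_signMatrix, htr]
  simp

/-- Orthonormality of the columns of `U` even gives equality. This is the contraction hypothesis of
`sum_signs_exp_sq_le`. -/
lemma sum_sq_overlapCoeff_le {U : Matrix (Fin D) (Fin s) ℝ} (hU : U.transpose * U = 1)
    (z : Fin s × Fin r → ℝ) :
    ∑ x, (∑ p, z p * overlapCoeff U p x) ^ 2 ≤ ∑ p, z p ^ 2 := by
  have hU' : ∀ m n, ∑ i, U i m * U i n = if m = n then 1 else 0 := fun m n => by
    have := congrFun (congrFun hU m) n
    simpa [Matrix.mul_apply, Matrix.one_apply] using this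
  refine le_of_eq ?_
  rw [Fintype.sum_prod_type_right, Fintype.sum_prod_type_right]
  refine Finset.sum_congr rfl fun k _ => ?_
  have e1 : ∀ i, ∑ p : Fin s × Fin r, z p * overlapCoeff U p (i, k) =
      ∑ m, z (m, k) * U i m := by
    intro i
    rw [Fintype.sum_prod_type]
    simp [overlapCoeff]
  simp_rw [e1]
  calc _ = ∑ i, ∑ m, ∑ n, z (m, k) * z (n, k) * (U i m * U i n) := by
        refine Finset.sum_congr rfl fun i _ => ?_
        rw [sq, Finset.sum_mul_sum]
        exact Finset.sum_congr rfl fun m _ => Finset.sum_congr rfl fun n _ => by ring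
    _ = ∑ m, ∑ n, z (m, k) * z (n, k) * ∑ i, U i m * U i n := by
        rw [Finset.sum_comm]
        refine Finset.sum_congr rfl fun m _ => ?_
        rw [Finset.sum_comm]
        simp_rw [Finset.mul_sum]
    _ = _ := by simp [hU', sq]

lemma sum_exp_overlap_le {U : Matrix (Fin D) (Fin s) ℝ} (hU : U.transpose * U = 1) :
    ∑ g : Fin D × Fin r → ℤˣ, Real.exp (overlap U g / 4) ≤ 2 ^ (D * r) * √2 ^ (s * r) := by
  simpa [overlap] using sum_signs_exp_sq_le (overlapCoeff U) (sum_sq_overlapCoeff_le hU)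

lemma sum_overlap {U : Matrix (Fin D) (Fin s) ℝ} (hU : U.transpose * U = 1) :
    ∑ g : Fin D × Fin r → ℤˣ, overlap U g = 2 ^ (D * r) * (s * r) := by
  have hU' : ∀ m, ∑ i, U i m ^ 2 = 1 := fun m => by
    have := congrFun (congrFun hU m) m
    simpa [Matrix.mul_apply, Matrix.one_apply, sq] using this
  have := sum_signs_sq_norm (overlapCoeff (r := r) U)
  simp_rw [overlap, this]
  have e : ∀ p : Fin s × Fin r, ∑ x, overlapCoeff U p x ^ 2 = 1 := by
    intro p
    rw [Fintype.sum_prod_type]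
    simp [overlapCoeff, ite_pow, hU']
  simp [e]

end Matrices

/-! ### How little one measurement reveals about a random state. -/

section Effects

variable {D r : ℕ}

open scoped MatrixOrder in
lemma expVal_nonneg {E ρ : Matrix (Fin D) (Fin D) ℂ} (hE : E.PosSemidef) (hρ : ρ.PosSemidef) :
    0 ≤ expVal E ρ := by
  obtain ⟨C, rfl⟩ := CStarAlgebra.nonneg_iff_eq_star_mul_self.mp hρ.nonneg
  have h := (hE.mul_mul_conjTranspose_same C).trace_nonneg
  rw [Matrix.mul_assoc, Matrix.trace_mul_comm, Matrix.mul_assoc] at h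
  exact (Complex.nonneg_iff.1 h).1

/-- The trace of a measurement effect. -/
def effectTrace (E : Matrix (Fin D) (Fin D) ℂ) : ℝ := ∑ i, (E i i).re

/-- The principal `2 × 2` minor on `i, j` is nonnegative. -/
lemma re_sq_le_of_posSemidef {E : Matrix (Fin D) (Fin D) ℂ} (hE : E.PosSemidef) (i j : Fin D) :
    (E i j).re ^ 2 ≤ (E i i).re * (E j j).re := by
  have h := (hE.submatrix ![i, j]).det_nonneg
  have hji : E j i = star (E i j) := (hE.1.apply j i).symm
  have him : ∀ a, (E a a).im = 0 := fun a => (Complex.nonneg_iff.1 (hE.diag_nonneg (i := a))).2.symm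
  rw [Matrix.det_fin_two] at h
  simp only [Matrix.submatrix_apply, Matrix.cons_val_zero, Matrix.cons_val_one, hji] at h
  have h2 := (Complex.nonneg_iff.1 h).1
  simp [him] at h2
  nlinarith [sq_nonneg (E i j).im]

lemma sum_re_sq_le {E : Matrix (Fin D) (Fin D) ℂ} (hE : E.PosSemidef) :
    ∑ i, ∑ j, (E i j).re ^ 2 ≤ effectTrace E ^ 2 := by
  rw [sq, effectTrace, Finset.sum_mul_sum]
  exact Finset.sum_le_sum fun i _ => Finset.sum_le_sum fun j _ => re_sq_le_of_posSemidef hE i j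

lemma effectTrace_nonneg {E : Matrix (Fin D) (Fin D) ℂ} (hE : E.PosSemidef) :
    0 ≤ effectTrace E :=
  Finset.sum_nonneg fun i _ => (Complex.nonneg_iff.1 (hE.diag_nonneg (i := i))).1

lemma sum_effectTrace {l : ℕ} (F : POVM D l) : ∑ j, effectTrace (F.effect j) = D := by
  have h := congrArg (fun X : Matrix (Fin D) (Fin D) ℂ => X.trace.re) F.sum_eq_one
  simp only [Matrix.trace_sum, Complex.re_sum, Matrix.trace_one] at h
  simpa [effectTrace, Matrix.trace] using h

lemma sum_expVal {l : ℕ} (F : POVM D l) {ρ : Matrix (Fin D) (Fin D) ℂ} (hρ : IsDensityMatrix ρ) :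
    ∑ j, expVal (F.effect j) ρ = 1 := by
  simp only [expVal, ← Complex.re_sum, ← Matrix.trace_sum, ← Finset.sum_mul, F.sum_eq_one]
  simp [hρ.2]

/-- The coefficients of the off-diagonal part of the quadratic form `g ↦ tr (E G Gᵀ)`. -/
def offDiagCoeff (E : Matrix (Fin D) (Fin D) ℂ) (x y : Fin D × Fin r) : ℝ :=
  if x.2 = y.2 then if x.1 = y.1 then 0 else (E x.1 y.1).re else 0

/-- The off-diagonal part of `tr (E G Gᵀ)`. -/
def deviation (E : Matrix (Fin D) (Fin D) ℂ) (g : Fin D × Fin r → ℤˣ) : ℝ :=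
  ∑ x, ∑ y, offDiagCoeff E x y * (sgn g x * sgn g y)

lemma sum_sq_deviation_le {E : Matrix (Fin D) (Fin D) ℂ} (hE : E.PosSemidef) :
    ∑ g : Fin D × Fin r → ℤˣ, deviation E g ^ 2 ≤
      2 ^ (D * r) * (2 * (r * effectTrace E ^ 2)) := by
  have hsym : ∀ i j, (E i j).re = (E j i).re := fun i j => by
    rw [← hE.1.apply j i]; simp
  have h := sum_sq_quadratic_signs (offDiagCoeff (r := r) E)
    (fun x y => by simp only [offDiagCoeff, eq_comm, hsym x.1 y.1]) (fun x => by simp [offDiagCoeff])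
  simp only [deviation, h, Fintype.card_prod, Fintype.card_fin]
  gcongr
  have e : ∀ x : Fin D × Fin r, ∑ y, offDiagCoeff E x y ^ 2 ≤ ∑ j, (E x.1 j).re ^ 2 := by
    intro x
    rw [Fintype.sum_prod_type]
    refine Finset.sum_le_sum fun j _ => ?_
    simp only [offDiagCoeff, ite_pow]
    simp
    split_ifs
    · positivity
    · exact le_rfl
  calc _ ≤ ∑ x : Fin D × Fin r, ∑ j, (E x.1 j).re ^ 2 := Finset.sum_le_sum fun x _ => e x
    _ = r * ∑ i, ∑ j, (E i j).re ^ 2 := by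
        rw [Fintype.sum_prod_type]
        simp [Finset.mul_sum]
    _ ≤ _ := by gcongr; exact sum_re_sq_le hE

lemma deviation_eq_zero {E : Matrix (Fin D) (Fin D) ℂ} (hE : E.PosSemidef)
    (h : effectTrace E = 0) (g : Fin D × Fin r → ℤˣ) : deviation E g = 0 := by
  have h1 := sum_sq_deviation_le (r := r) hE
  rw [h] at h1
  have h2 := Finset.single_le_sum (f := fun g => deviation E g ^ 2)
    (fun g _ => sq_nonneg _) (Finset.mem_univ g)
  have : deviation E g ^ 2 ≤ 0 := by
    refine h2.trans (h1.trans ?_)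
    simp
  exact pow_eq_zero_iff two_ne_zero |>.1 (le_antisymm this (sq_nonneg _))

/-- The diagonal of `G Gᵀ` is exactly `r`, so it contributes the same as the maximally mixed state;
all the randomness is off-diagonal. -/
lemma expVal_signState (hr : 0 < r) (E : Matrix (Fin D) (Fin D) ℂ) (η : ℝ)
    (g : Fin D × Fin r → ℤˣ) :
    expVal E (toComplex (signState η g)) = effectTrace E / D + η / (D * r) * deviation E g := by
  have hr' : (r : ℝ) ≠ 0 := by positivity
  have hdev : deviation E g =
      ∑ i, ∑ j, (E i j).re * ((∑ k, sgn g (j, k) * sgn g (i, k)) - if i = j then (r : ℝ) else 0) := by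
    have e1 : ∀ i k, ∑ y, offDiagCoeff E (i, k) y * (sgn g (i, k) * sgn g y) =
        ∑ j, if i = j then 0 else (E i j).re * (sgn g (i, k) * sgn g (j, k)) := by
      intro i k
      rw [Fintype.sum_prod_type]
      refine Finset.sum_congr rfl fun j _ => ?_
      by_cases h : i = j <;> simp [offDiagCoeff, h]
    rw [deviation, Fintype.sum_prod_type]
    simp_rw [e1]
    refine Finset.sum_congr rfl fun i _ => ?_
    rw [Finset.sum_comm]
    refine Finset.sum_congr rfl fun j _ => ?_
    by_cases h : i = j
    · subst h; simp [sgn_mul_self]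
    · simp [h, Finset.mul_sum, mul_comm (sgn g (j, _))]
  have e2 : effectTrace E = ∑ i, ∑ j, (E i j).re * if i = j then 1 else 0 := by
    simp [effectTrace]
  rw [expVal_toComplex, hdev, e2, Finset.sum_div, Finset.mul_sum, ← Finset.sum_add_distrib]
  refine Finset.sum_congr rfl fun i _ => ?_
  rw [Finset.sum_div, Finset.mul_sum, ← Finset.sum_add_distrib]
  refine Finset.sum_congr rfl fun j _ => ?_
  simp only [signState, signMatrix, Matrix.add_apply, Matrix.smul_apply, Matrix.mul_apply,
    Matrix.one_apply, Matrix.transpose_apply, Matrix.of_apply, smul_eq_mul, @eq_comm _ j i]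
  by_cases hD : (D : ℝ) = 0
  · simp [hD]
  split_ifs
  · field_simp
    ring
  · ring

/-- The `χ²`-divergence of the outcome distribution of `ρ` from the one of `σ`. -/
noncomputable def chiSq {l : ℕ} (F : POVM D l) (ρ σ : Matrix (Fin D) (Fin D) ℂ) : ℝ :=
  ∑ j, (expVal (F.effect j) ρ - expVal (F.effect j) σ) ^ 2 / expVal (F.effect j) σ

/-- The maximally mixed state. -/
noncomputable def mixedState (D : ℕ) : Matrix (Fin D) (Fin D) ℂ :=
  toComplex ((1 / D : ℝ) • (1 : Matrix (Fin D) (Fin D) ℝ))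

lemma expVal_mixedState (E : Matrix (Fin D) (Fin D) ℂ) :
    expVal E (mixedState D) = effectTrace E / D := by
  rw [mixedState, expVal_toComplex, effectTrace, Finset.sum_div]
  refine Finset.sum_congr rfl fun i _ => ?_
  rw [Finset.sum_eq_single i] <;> simp +contextual [div_eq_mul_inv]

lemma isDensityMatrix_mixedState (hD : 0 < D) : IsDensityMatrix (mixedState D) := by
  have hD' : (D : ℝ) ≠ 0 := by positivity
  constructor
  · refine posSemidef_toComplex_smul ?_ (by positivity)
    rw [toComplex_one]; exact Matrix.PosSemidef.one
  · rw [mixedState, trace_toComplex, ← Complex.ofReal_one]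
    congr 1
    simp [hD']

/-- Absolute continuity: because division by zero gives zero, `chiSq` would not see outcomes that
are impossible under the reference state. -/
lemma expVal_signState_eq_zero (hD : 0 < D) (hr : 0 < r) {E : Matrix (Fin D) (Fin D) ℂ}
    (hE : E.PosSemidef) (h : expVal E (mixedState D) = 0) (η : ℝ) (g : Fin D × Fin r → ℤˣ) :
    expVal E (toComplex (signState η g)) = 0 := by
  have hD' : (D : ℝ) ≠ 0 := by positivity
  rw [expVal_mixedState, div_eq_zero_iff, or_iff_left hD'] at h
  rw [expVal_signState hr, h, deviation_eq_zero hE h]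
  simp

lemma chiSq_nonneg {l : ℕ} (F : POVM D l) {ρ σ : Matrix (Fin D) (Fin D) ℂ} (hσ : σ.PosSemidef) :
    0 ≤ chiSq F ρ σ :=
  Finset.sum_nonneg fun j _ => div_nonneg (sq_nonneg _) (expVal_nonneg (F.posSemidef j) hσ)

/-- An effect of trace `T` has mean squared deviation at most `(η / (D r))² · 2 r T²` and reference
probability `T / D`. The quotient is linear in `T`, and the traces add up to `D`. -/
lemma sum_chiSq_signState_le (hD : 0 < D) (hr : 0 < r) {l : ℕ} (F : POVM D l) (η : ℝ) :
    ∑ g : Fin D × Fin r → ℤˣ, chiSq F (toComplex (signState η g)) (mixedState D) ≤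
      2 ^ (D * r) * (2 * η ^ 2 / r) := by
  have hD' : (0 : ℝ) < D := by positivity
  have hr' : (0 : ℝ) < r := by positivity
  simp only [chiSq]
  rw [Finset.sum_comm]
  have e : ∀ j, ∑ g : Fin D × Fin r → ℤˣ, (expVal (F.effect j) (toComplex (signState η g)) -
      expVal (F.effect j) (mixedState D)) ^ 2 / expVal (F.effect j) (mixedState D) ≤
      2 ^ (D * r) * (2 * η ^ 2 / r) / D * effectTrace (F.effect j) := by
    intro j
    have hT := effectTrace_nonneg (F.posSemidef j)
    simp_rw [expVal_mixedState, expVal_signState hr, add_sub_cancel_left, mul_pow]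
    rw [← Finset.sum_div, ← Finset.mul_sum]
    rcases hT.eq_or_lt with h | h
    · simp [← h]
    · have := sum_sq_deviation_le (r := r) (F.posSemidef j)
      rw [div_le_iff₀ (by positivity)]
      calc _ ≤ (η / (D * r)) ^ 2 * (2 ^ (D * r) * (2 * (r * effectTrace (F.effect j) ^ 2))) := by
            gcongr
        _ = _ := by field_simp
  refine (Finset.sum_le_sum fun j _ => e j).trans_eq ?_
  rw [← Finset.mul_sum, sum_effectTrace]
  field_simp

end Effects

/-! ### From feature prediction to state identification, and its cost in `χ²`. -/

section Identification

/-- Cauchy–Schwarz with weight `q`, together with `a² ≤ a`. Keeping the factor `∑ q a`, which can be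
as small as `1 / M`, is what yields a logarithm of `M` later. -/
lemma sq_sub_le_chiSq {Y : Type*} [Fintype Y] {p q a : Y → ℝ} (hq : ∀ y, 0 ≤ q y)
    (hp1 : ∑ y, p y = 1) (hq1 : ∑ y, q y = 1) (hpq : ∀ y, q y = 0 → p y = 0)
    (ha0 : ∀ y, 0 ≤ a y) (ha1 : ∀ y, a y ≤ 1) :
    (∑ y, p y * a y - ∑ y, q y * a y) ^ 2 ≤
      (∑ y, q y * a y) * (∑ y, p y ^ 2 / q y - 1) := by
  have e1 : ∑ y, p y * a y - ∑ y, q y * a y =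
      ∑ y, (√(q y) * a y) * ((p y - q y) / √(q y)) := by
    rw [← Finset.sum_sub_distrib]
    refine Finset.sum_congr rfl fun y _ => ?_
    rcases (hq y).eq_or_lt with h | h
    · simp [← h, hpq y h.symm]
    · have : √(q y) ≠ 0 := by positivity
      field_simp
  have e2 : ∑ y, p y ^ 2 / q y - 1 = ∑ y, ((p y - q y) / √(q y)) ^ 2 := by
    have : ∀ y, ((p y - q y) / √(q y)) ^ 2 = p y ^ 2 / q y - 2 * p y + q y := by
      intro y
      rw [div_pow, Real.sq_sqrt (hq y)]
      rcases (hq y).eq_or_lt with h | h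
      · simp [← h, hpq y h.symm]
      · field_simp; ring
    simp_rw [this, Finset.sum_add_distrib, Finset.sum_sub_distrib, ← Finset.mul_sum, hp1, hq1]
    ring
  rw [e1, e2]
  refine (Finset.sum_mul_sq_le_sq_mul_sq _ _ _).trans ?_
  gcongr with y
  rw [mul_pow, Real.sq_sqrt (hq y)]
  exact mul_le_mul_of_nonneg_left (by nlinarith [ha0 y, ha1 y]) (hq y)

variable {D N M : ℕ} {l : Fin N → ℕ}

lemma sum_outcomeProb (F : ∀ k, POVM D (l k)) {ρ : Matrix (Fin D) (Fin D) ℂ}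
    (hρ : IsDensityMatrix ρ) : ∑ y, outcomeProb F ρ y = 1 := by
  have := Finset.prod_univ_sum (fun k => (Finset.univ : Finset (Fin (l k))))
    (fun k j => expVal ((F k).effect j) ρ)
  rw [Fintype.piFinset_univ] at this
  simp only [outcomeProb, ← this, sum_expVal _ hρ, Finset.prod_const_one]

/-- `1 + χ²` is multiplicative over independent copies, and `1 + u ≤ exp u`. -/
lemma sum_outcomeProb_sq_div_le (F : ∀ k, POVM D (l k)) {ρ σ : Matrix (Fin D) (Fin D) ℂ}
    (hρ : IsDensityMatrix ρ) (hσ : IsDensityMatrix σ)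
    (hac : ∀ k j, expVal ((F k).effect j) σ = 0 → expVal ((F k).effect j) ρ = 0) :
    ∑ y, outcomeProb F ρ y ^ 2 / outcomeProb F σ y ≤ Real.exp (∑ k, chiSq (F k) ρ σ) := by
  have := Finset.prod_univ_sum (fun k => (Finset.univ : Finset (Fin (l k))))
    (fun k j => expVal ((F k).effect j) ρ ^ 2 / expVal ((F k).effect j) σ)
  rw [Fintype.piFinset_univ] at this
  simp only [outcomeProb, ← Finset.prod_pow, ← Finset.prod_div_distrib, ← this, Real.exp_sum]
  refine Finset.prod_le_prod (fun k _ => Finset.sum_nonneg fun j _ => div_nonneg (sq_nonneg _)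
    (expVal_nonneg ((F k).posSemidef j) hσ.1)) fun k _ => ?_
  have e : ∑ j, expVal ((F k).effect j) ρ ^ 2 / expVal ((F k).effect j) σ =
      chiSq (F k) ρ σ + 1 := by
    have : ∀ j, (expVal ((F k).effect j) ρ - expVal ((F k).effect j) σ) ^ 2 /
        expVal ((F k).effect j) σ = expVal ((F k).effect j) ρ ^ 2 / expVal ((F k).effect j) σ -
          2 * expVal ((F k).effect j) ρ + expVal ((F k).effect j) σ := by
      intro j
      by_cases h : expVal ((F k).effect j) σ = 0
      · simp [h, hac k j h]
      · field_simp; ring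
    simp_rw [chiSq, this, Finset.sum_add_distrib, Finset.sum_sub_distrib, ← Finset.mul_sum,
      sum_expVal _ hρ, sum_expVal _ hσ]
    ring
  rw [e]
  exact Real.add_one_le_exp _

/-- If a (fuzzy) test identifies each of `M` states with probability `2/3` from the outcomes, then
`log M` is bounded by the `χ²`-divergences of the outcome distributions from a reference state. -/
lemma log_le_of_identification (F : ∀ k, POVM D (l k)) (hM : 2 ≤ M)
    {ρ : Fin M → Matrix (Fin D) (Fin D) ℂ} {σ : Matrix (Fin D) (Fin D) ℂ}
    (hρ : ∀ i, IsDensityMatrix (ρ i)) (hσ : IsDensityMatrix σ)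
    (hac : ∀ i k j, expVal ((F k).effect j) σ = 0 → expVal ((F k).effect j) (ρ i) = 0)
    {a : Fin M → (∀ k, Fin (l k)) → ℝ} (ha0 : ∀ i y, 0 ≤ a i y) (ha1 : ∀ y, ∑ i, a i y ≤ 1)
    (hsucc : ∀ i, 2 / 3 ≤ ∑ y, outcomeProb F (ρ i) y * a i y)
    {X : ℝ} (hX : ∀ i, ∑ k, chiSq (F k) (ρ i) σ ≤ X) :
    Real.log M ≤ 36 * X := by
  have hM' : (2 : ℝ) ≤ M := by exact_mod_cast hM
  have hq : ∀ y, 0 ≤ outcomeProb F σ y := fun y =>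
    Finset.prod_nonneg fun k _ => expVal_nonneg ((F k).posSemidef _) hσ.1
  -- The tests sum to at most `1`, so under the reference state some test accepts with probability
  -- at most `1 / M`.
  obtain ⟨i, hi⟩ : ∃ i, ∑ y, outcomeProb F σ y * a i y ≤ 1 / M := by
    by_contra! h
    have h1 : ∑ _i : Fin M, (1 / M : ℝ) < ∑ i, ∑ y, outcomeProb F σ y * a i y :=
      Finset.sum_lt_sum_of_nonempty ⟨⟨0, by omega⟩, Finset.mem_univ _⟩ fun i _ => h i
    rw [Finset.sum_comm] at h1
    simp_rw [← Finset.mul_sum] at h1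
    have h2 : ∑ y, outcomeProb F σ y * ∑ i, a i y ≤ 1 := by
      rw [← sum_outcomeProb F hσ]
      exact Finset.sum_le_sum fun y _ => mul_le_of_le_one_right (hq y) (ha1 y)
    have h3 : ∑ _i : Fin M, (1 / M : ℝ) = 1 := by
      simp; field_simp
    linarith
  have ht0 : 0 ≤ ∑ y, outcomeProb F σ y * a i y :=
    Finset.sum_nonneg fun y _ => mul_nonneg (hq y) (ha0 i y)
  have hpq : ∀ y, outcomeProb F σ y = 0 → outcomeProb F (ρ i) y = 0 := by
    intro y hy
    obtain ⟨k, hk, h⟩ := Finset.prod_eq_zero_iff.1 hy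
    exact Finset.prod_eq_zero hk (hac i k _ h)
  have hchi := sq_sub_le_chiSq hq (sum_outcomeProb F (hρ i)) (sum_outcomeProb F hσ) hpq (ha0 i)
    (fun y => (Finset.single_le_sum (fun i _ => ha0 i y) (Finset.mem_univ i)).trans (ha1 y))
  have hexp := (sum_outcomeProb_sq_div_le F (hρ i) hσ (hac i)).trans (Real.exp_le_exp.2 (hX i))
  have hs := hsucc i
  set t := ∑ y, outcomeProb F σ y * a i y
  set P := ∑ y, outcomeProb F (ρ i) y * a i y
  set Z := ∑ y, outcomeProb F (ρ i) y ^ 2 / outcomeProb F σ y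
  have hhalf : 1 / (M : ℝ) ≤ 1 / 2 := one_div_le_one_div_of_le (by norm_num) hM'
  have h36 : (1 / 6) ^ 2 ≤ (P - t) ^ 2 := by
    apply pow_le_pow_left₀ (by norm_num)
    linarith
  have hZ : 0 ≤ Z - 1 := by
    by_contra! hneg
    nlinarith
  have h1 : 1 / 36 ≤ 1 / (M : ℝ) * (Real.exp X - 1) := by
    calc (1 / 36 : ℝ) ≤ t * (Z - 1) := by linarith
      _ ≤ 1 / M * (Z - 1) := by gcongr
      _ ≤ _ := by gcongr
  have h2 : 1 + (M : ℝ) / 36 ≤ Real.exp X := by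
    have : (M : ℝ) * (1 / 36) ≤ M * (1 / (M : ℝ) * (Real.exp X - 1)) := by gcongr
    rw [← mul_assoc, mul_one_div_cancel (by positivity)] at this
    linarith
  -- Bernoulli's inequality with exponent `36` absorbs the factor `1 / 36 = (2 / 3 - 1 / 2)²`.
  have h3 : (M : ℝ) ≤ Real.exp (36 * X) := by
    have hb := one_add_mul_le_pow (a := (M : ℝ) / 36) (by linarith [show (0 : ℝ) ≤ M / 36 by positivity]) 36
    have hpow : (1 + (M : ℝ) / 36) ^ 36 ≤ Real.exp X ^ 36 := by gcongr
    rw [← Real.exp_nat_mul] at hpow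
    push_cast at hb hpow
    linarith
  exact (Real.log_le_iff_le_exp (by positivity)).2 h3

/-- Accurate predictions of the features identify the state: the smallest index whose prediction
exceeds its threshold is the right one. -/
lemma exists_identification {B ε : ℝ} (F : ∀ k, POVM D (l k)) (hF : AllowsPrediction F M B ε (2 / 3))
    {O ρ : Fin M → Matrix (Fin D) (Fin D) ℂ} (hO : ∀ i, IsFeature B (O i))
    (hρ : ∀ i, IsDensityMatrix (ρ i))
    (hgap : ∀ i j, i < j → expVal (O i) (ρ j) + 2 * ε < expVal (O i) (ρ i)) :
    ∃ a : Fin M → (∀ k, Fin (l k)) → ℝ, (∀ i y, 0 ≤ a i y) ∧ (∀ y, ∑ i, a i y ≤ 1) ∧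
      ∀ i, 2 / 3 ≤ ∑ y, outcomeProb F (ρ i) y * a i y := by
  obtain ⟨A, hA⟩ := hF O hO
  let t : Fin M → ℝ := fun i => expVal (O i) (ρ i) - ε
  let S : Fin M → Set (Fin M → ℝ) := fun j => {o | t j ≤ o j ∧ ∀ i < j, o i < t i}
  have hS : ∀ j, MeasurableSet (S j) := by
    intro j
    refine MeasurableSet.inter (measurableSet_le measurable_const (measurable_pi_apply j)) ?_
    have : {o : Fin M → ℝ | ∀ i < j, o i < t i} = ⋂ i, ⋂ (_ : i < j), {o | o i < t i} := by
      ext; simp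
    change MeasurableSet {o : Fin M → ℝ | ∀ i < j, o i < t i}
    rw [this]
    exact MeasurableSet.iInter fun i => MeasurableSet.iInter fun _ =>
      measurableSet_lt (measurable_pi_apply i) measurable_const
  have hdisj : Pairwise (Function.onFun Disjoint S) := by
    have hlt : ∀ i j, i < j → Disjoint (S i) (S j) := fun i j hij =>
      Set.disjoint_left.2 fun o hi hj => (hj.2 i hij).not_ge hi.1
    intro i j hij
    rcases hij.lt_or_gt with h | h
    · exact hlt i j h
    · exact (hlt j i h).symm
  refine ⟨fun j y => (A y : Measure (Fin M → ℝ)).real (S j), fun _ _ => measureReal_nonneg,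
    fun y => ?_, fun j => ?_⟩
  · rw [← measureReal_iUnion_fintype hdisj hS]
    exact measureReal_le_one
  · refine (hA (ρ j) (hρ j)).trans (Finset.sum_le_sum fun y _ => ?_)
    refine mul_le_mul_of_nonneg_left (measureReal_mono ?_)
      (Finset.prod_nonneg fun k _ => expVal_nonneg ((F k).posSemidef _) (hρ j).1)
    intro o ho
    refine ⟨?_, fun i hij => ?_⟩
    · have := (abs_le.1 (ho j)).1
      simp only [t]; linarith
    · have := (abs_le.1 (ho i)).2
      have := hgap i j hij
      simp only [t]; linarith

/-- Pad the list with zero features and forget their predictions. -/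
lemma AllowsPrediction.mono_left {M' : ℕ} {B ε p : ℝ} (hB : 0 ≤ B) {F : ∀ k, POVM D (l k)}
    (hF : AllowsPrediction F M B ε p) (h : M' ≤ M) : AllowsPrediction F M' B ε p := by
  intro O hO
  obtain ⟨A, hA⟩ := hF (fun i => if hi : (i : ℕ) < M' then O ⟨i, hi⟩ else 0) (by
    intro i
    split_ifs
    · exact hO _
    · exact ⟨Matrix.PosSemidef.zero, by simpa using Matrix.PosSemidef.one, by simpa [hsNormSq]⟩)
  have hmeas : Measurable fun o : Fin M → ℝ => o ∘ Fin.castLE h :=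
    measurable_pi_lambda _ fun i => measurable_pi_apply _
  refine ⟨fun y => (A y).map hmeas.aemeasurable, fun ρ hρ => (hA ρ hρ).trans ?_⟩
  refine Finset.sum_le_sum fun y _ => mul_le_mul_of_nonneg_left ?_
    (Finset.prod_nonneg fun k _ => expVal_nonneg ((F k).posSemidef _) hρ.1)
  have hset : MeasurableSet {o : Fin M' → ℝ | ∀ i, |o i - expVal (O i) ρ| ≤ ε} := by
    simp only [Set.ofPred_forall]
    exact MeasurableSet.iInter fun i => measurableSet_le (by fun_prop) measurable_const
  rw [ProbabilityMeasure.toMeasure_map, map_measureReal_apply hmeas hset]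
  refine measureReal_mono fun o ho i => ?_
  simpa using ho (Fin.castLE h i)

end Identification

/-! ### Greedy selection and concentration of the overlap. -/

section Packing

/-- Greedy choice: each chosen element excludes at most `b` others. Only later elements must avoid
earlier bad sets, which is all that `exists_identification` asks for. -/
lemma exists_sequence_of_card_lt {Ω : Type*} [Fintype Ω] [DecidableEq Ω] (S : Finset Ω)
    (bad : Ω → Finset Ω) {b : ℝ} (hb0 : 0 ≤ b) (hb : ∀ g, ((bad g).card : ℝ) ≤ b) (M : ℕ)
    (hM : M * b < S.card) :
    ∃ f : Fin M → Ω, (∀ i, f i ∈ S) ∧ ∀ i j, i < j → f j ∉ bad (f i) := by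
  induction M with
  | zero => exact ⟨Fin.elim0, fun i => i.elim0, fun i => i.elim0⟩
  | succ M ih =>
    have hcard : ∀ f : Fin M → Ω,
        ((Finset.univ.biUnion fun i => bad (f i)).card : ℝ) ≤ M * b := by
      intro f
      calc _ ≤ ((∑ i, (bad (f i)).card : ℕ) : ℝ) := by exact_mod_cast Finset.card_biUnion_le
        _ ≤ ∑ _i : Fin M, b := by push_cast; exact Finset.sum_le_sum fun i _ => hb _
        _ = _ := by simp
    have hM' : M * b < S.card := by
      push_cast at hM; linarith
    obtain ⟨f, hf, hsep⟩ := ih hM'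
    obtain ⟨h, hh, hnot⟩ : ∃ h ∈ S, h ∉ Finset.univ.biUnion fun i => bad (f i) := by
      refine Finset.exists_mem_notMem_of_card_lt_card ?_
      exact_mod_cast (hcard f).trans_lt hM'
    refine ⟨Fin.snoc f h, fun i => ?_, fun i j => ?_⟩
    · refine Fin.lastCases ?_ (fun i => ?_) i
      · simpa using hh
      · simpa using hf i
    · refine Fin.lastCases (fun hij => ?_) (fun j hij => ?_) j
      · refine Fin.lastCases (fun hij => absurd hij (lt_irrefl _)) (fun i _ => ?_) i hij
        simp only [Fin.snoc_last, Fin.snoc_castSucc]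
        exact fun hmem => hnot (Finset.mem_biUnion.2 ⟨i, Finset.mem_univ _, hmem⟩)
      · refine Fin.lastCases (fun hij => absurd hij (Fin.castSucc_lt_last j).not_gt)
          (fun i hij => ?_) i hij
        simp only [Fin.snoc_castSucc]
        exact hsep i j (by simpa using hij)

/-- Markov's inequality for the counting measure. -/
lemma half_card_le_of_sum_le {Ω : Type*} [Fintype Ω] {f : Ω → ℝ} (hf : ∀ g, 0 ≤ f g) {X : ℝ}
    (hX : 0 < X) (h : ∑ g, f g ≤ Fintype.card Ω * X) :
    (Fintype.card Ω : ℝ) / 2 ≤ (Finset.univ.filter fun g => f g ≤ 2 * X).card := by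
  have h1 : ((Finset.univ.filter fun g => ¬ f g ≤ 2 * X).card : ℝ) * (2 * X) ≤ ∑ g, f g := by
    rw [← nsmul_eq_mul]
    refine (Finset.card_nsmul_le_sum _ f _ fun g hg => ?_).trans
      (Finset.sum_le_sum_of_subset_of_nonneg (Finset.filter_subset _ _) fun g _ _ => hf g)
    exact (not_le.1 (Finset.mem_filter.1 hg).2).le
  have h2 : ((Finset.univ.filter fun g => f g ≤ 2 * X).card : ℝ) +
      (Finset.univ.filter fun g => ¬ f g ≤ 2 * X).card = Fintype.card Ω := by
    exact_mod_cast Finset.card_filter_add_card_filter_not (s := Finset.univ) (fun g => f g ≤ 2 * X)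
  have h3 : ((Finset.univ.filter fun g => ¬ f g ≤ 2 * X).card : ℝ) * 2 ≤ Fintype.card Ω := by
    refine le_of_mul_le_mul_right ?_ hX
    linarith
  linarith

variable {D r s : ℕ}

/-- Chernoff bound: the threshold gains `exp (-D r / 8)`, while the exponential moment costs `√2 ^
(s r) ≤ exp (s r / 2) ≤ exp (D r / 16)` because `s ≤ r ≤ D / 8`. -/
lemma card_overlap_gt_le {U : Matrix (Fin D) (Fin s) ℝ} (hU : U.transpose * U = 1) (hs : s ≤ r)
    (hr : 8 * r ≤ D) :
    ((Finset.univ.filter fun g : Fin D × Fin r → ℤˣ => ¬ overlap U g ≤ D * r / 2).card : ℝ) ≤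
      2 ^ (D * r) * Real.exp (-(D * r / 16)) := by
  have hr' : 8 * (r : ℝ) ≤ D := by exact_mod_cast hr
  have h1 : ((Finset.univ.filter fun g : Fin D × Fin r → ℤˣ =>
      ¬ overlap U g ≤ D * r / 2).card : ℝ) * Real.exp (D * r / 8) ≤
      ∑ g : Fin D × Fin r → ℤˣ, Real.exp (overlap U g / 4) := by
    rw [← nsmul_eq_mul]
    refine (Finset.card_nsmul_le_sum _ (fun g => Real.exp (overlap U g / 4)) _ fun g hg => ?_).trans
      (Finset.sum_le_sum_of_subset_of_nonneg (Finset.filter_subset _ _) fun g _ _ => by positivity)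
    have := not_le.1 (Finset.mem_filter.1 hg).2
    exact Real.exp_le_exp.2 (by linarith)
  have h2 : √2 ^ (s * r) ≤ Real.exp (D * r / 16) := by
    have h3 : √2 ≤ Real.exp (1 / 2) := by
      rw [Real.sqrt_le_left (by positivity), ← Real.exp_nat_mul]
      have := Real.add_one_le_exp (1 : ℝ)
      norm_num at this ⊢
      linarith
    calc √2 ^ (s * r) ≤ Real.exp (1 / 2) ^ (s * r) := by gcongr
      _ = Real.exp (s * r / 2) := by
          rw [← Real.exp_nat_mul]; push_cast; ring_nf
      _ ≤ _ := by
          have hs' : (s : ℝ) ≤ r := by exact_mod_cast hs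
          refine Real.exp_le_exp.2 ?_
          have : (s : ℝ) * r ≤ D / 8 * r := by gcongr; linarith
          linarith
  have h4 := h1.trans ((sum_exp_overlap_le hU).trans
    (mul_le_mul_of_nonneg_left h2 (by positivity)))
  rw [← le_div_iff₀ (Real.exp_pos _)] at h4
  refine h4.trans_eq ?_
  rw [mul_div_assoc, ← Real.exp_sub]
  ring_nf

end Packing

/-! ### Choice of parameters and the final bounds. -/

section LowerBound

variable {D r N M : ℕ} {l : Fin N → ℕ} {B ε : ℝ}

/-- Take `δ = min 1 √(B / r)`, the largest scale allowed by the norm bound, and `η = 5 ε / δ`. Then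
`δ² r ≥ B / 64` gives `η² / r ≤ 25 · 64 ε² / B`. -/
lemma exists_scaling (hr : 0 < r) (hε : 0 < ε) (hε6 : ε ≤ 1 / 6) (hB : 36 * ε ^ 2 * r ≤ B)
    (hB64 : B ≤ 64 * r) :
    ∃ δ η : ℝ, 0 ≤ δ ∧ δ ≤ 1 ∧ δ ^ 2 * r ≤ B ∧ 0 < η ∧ η ≤ 1 ∧ η * δ = 5 * ε ∧
      η ^ 2 / r ≤ 1600 * ε ^ 2 / B := by
  have hr' : (0 : ℝ) < r := by exact_mod_cast hr
  have hB0 : 0 < B := lt_of_lt_of_le (by positivity) hB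
  have hδ : 6 * ε ≤ min 1 √(B / r) := by
    refine le_min (by linarith) (Real.le_sqrt_of_sq_le ?_)
    rw [le_div_iff₀ hr']
    linarith
  have hδ2 : B / (64 * r) ≤ (min 1 √(B / r)) ^ 2 := by
    rcases min_choice 1 √(B / r) with h | h <;> rw [h]
    · rw [div_le_iff₀ (by positivity)]; linarith
    · rw [Real.sq_sqrt (by positivity)]
      gcongr
      linarith
  have hδ3 : (min 1 √(B / r)) ^ 2 * r ≤ B := by
    rw [← le_div_iff₀ hr', ← Real.le_sqrt' (by linarith)]
    exact min_le_right _ _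
  have hδ1 : min 1 √(B / r) ≤ 1 := min_le_left _ _
  set δ := min 1 √(B / r)
  have hδ0 : 0 < δ := by linarith
  refine ⟨δ, 5 * ε / δ, hδ0.le, hδ1, hδ3, by positivity, ?_, by field_simp, ?_⟩
  · rw [div_le_one hδ0]; linarith
  · rw [div_pow, div_div, div_le_div_iff₀ (by positivity) hB0]
    rw [div_le_iff₀ (by positivity)] at hδ2
    nlinarith [sq_nonneg ε]

/-- The term `(1 - η) s / D` is the same for all states, so varying ranks do no harm; the gap is at
least `η δ / 2 > 2 ε`. -/
lemma log_le_of_separated (hD : 0 < D) (hr : 0 < r) (hM : 2 ≤ M) (F : ∀ k, POVM D (l k))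
    (hF : AllowsPrediction F M B ε (2 / 3)) {δ η : ℝ} (hδ0 : 0 ≤ δ) (hδ1 : δ ≤ 1)
    (hδB : δ ^ 2 * r ≤ B) (hη0 : 0 < η) (hη1 : η ≤ 1) (hηδ : 4 * ε < η * δ)
    {s : (Fin D × Fin r → ℤˣ) → ℕ} (hs : ∀ g, s g ≤ r)
    {U : ∀ g, Matrix (Fin D) (Fin (s g)) ℝ} (hU : ∀ g, (U g).transpose * U g = 1)
    (hUg : ∀ g, U g * (U g).transpose * signMatrix g = signMatrix g)
    (f : Fin M → Fin D × Fin r → ℤˣ)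
    (hsep : ∀ i j, i < j → overlap (U (f i)) (f j) ≤ D * r / 2) {X : ℝ}
    (hX : ∀ i, ∑ k, chiSq (F k) (toComplex (signState η (f i))) (mixedState D) ≤ X) :
    Real.log M ≤ 36 * X := by
  have hD' : (0 : ℝ) < D := by exact_mod_cast hD
  have hr' : (0 : ℝ) < r := by exact_mod_cast hr
  have hρ := fun i => isDensityMatrix_signState hD hr hη0.le hη1 (f i)
  obtain ⟨a, ha0, ha1, hsucc⟩ := exists_identification F hF
    (O := fun i => toComplex (projFeature δ (U (f i)))) (fun i =>
      isFeature_projFeature (hU _) hδ0 hδ1 (le_trans (mul_le_mul_of_nonneg_left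
        (by exact_mod_cast hs _) (sq_nonneg _)) hδB)) hρ (fun i j hij => by
      rw [expVal_projFeature_signState (hU _), expVal_projFeature_signState (hU _),
        overlap_self (hUg _)]
      have h1 : η / (D * r) * overlap (U (f i)) (f j) ≤ η / (D * r) * (D * r / 2) := by
        gcongr; exact hsep i j hij
      have h2 : η / (D * r) * (D * r / 2) = η / 2 := by field_simp
      have h3 : η / (D * r) * (D * r) = η := by field_simp
      rw [h3]
      rw [h2] at h1
      have := mul_le_mul_of_nonneg_left h1 hδ0
      linarith)
  exact log_le_of_identification F hM hρ (isDensityMatrix_mixedState hD)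
    (fun i k j h => expVal_signState_eq_zero hD hr ((F k).posSemidef j) h η (f i)) ha0 ha1 hsucc hX

lemma sum_sum_chiSq_le (hD : 0 < D) (hr : 0 < r) (F : ∀ k, POVM D (l k)) (η : ℝ) :
    ∑ g : Fin D × Fin r → ℤˣ, ∑ k, chiSq (F k) (toComplex (signState η g)) (mixedState D) ≤
      2 ^ (D * r) * (N * (2 * η ^ 2 / r)) := by
  rw [Finset.sum_comm]
  refine (Finset.sum_le_sum fun k _ => sum_chiSq_signState_le hD hr (F k) η).trans_eq ?_
  simp; ring

lemma sum_chiSq_nonneg (hD : 0 < D) (F : ∀ k, POVM D (l k)) (ρ : Matrix (Fin D) (Fin D) ℂ) :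
    0 ≤ ∑ k, chiSq (F k) ρ (mixedState D) :=
  Finset.sum_nonneg fun k _ => chiSq_nonneg (F k) (isDensityMatrix_mixedState hD).1

/-- The bound for a number of features at most exponential in `D r`. -/
lemma log_le_of_allowsPrediction (hr : 0 < r) (hrD : 8 * r ≤ D) (hDr : 64 ≤ D * r) (hM : 2 ≤ M)
    (hMexp : (M : ℝ) ≤ Real.exp (D * r / 32)) (F : ∀ k, POVM D (l k))
    (hF : AllowsPrediction F M B ε (2 / 3)) (hε : 0 < ε) (hε6 : ε ≤ 1 / 6)
    (hB : 36 * ε ^ 2 * r ≤ B) (hB64 : B ≤ 64 * r) :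
    Real.log M ≤ 230400 * ε ^ 2 / B * N := by
  have hD : 0 < D := by omega
  have hr' : (0 : ℝ) < r := by exact_mod_cast hr
  obtain ⟨δ, η, hδ0, hδ1, hδB, hη0, hη1, hηδ, hη⟩ := exists_scaling hr hε hε6 hB hB64
  choose s hs U hU hUg using fun g : Fin D × Fin r → ℤˣ => exists_orthonormal_columns (signMatrix g)
  have hcard : (Fintype.card (Fin D × Fin r → ℤˣ) : ℝ) = 2 ^ (D * r) := by simp
  set X : ℝ := 2 * (N * (2 * η ^ 2 / r))
  set S := Finset.univ.filter fun g : Fin D × Fin r → ℤˣ =>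
    ∑ k, chiSq (F k) (toComplex (signState η g)) (mixedState D) ≤ X
  have hS : (2 : ℝ) ^ (D * r) / 2 ≤ S.card := by
    -- For `N = 0` the threshold `X` vanishes and Markov's inequality does not apply.
    rcases N.eq_zero_or_pos with hN | hN
    · subst hN
      have : S = Finset.univ := Finset.filter_true_of_mem fun g _ => by simp [X]
      rw [this, Finset.card_univ, hcard]
      have : (0 : ℝ) < 2 ^ (D * r) := by positivity
      linarith
    · have hN' : (0 : ℝ) < N := by exact_mod_cast hN
      rw [← hcard]
      refine half_card_le_of_sum_le (fun g => sum_chiSq_nonneg hD F _) (by positivity) ?_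
      rw [hcard]
      exact sum_sum_chiSq_le hD hr F η
  have hDr' : (64 : ℝ) ≤ D * r := by exact_mod_cast hDr
  obtain ⟨f, hf, hsep⟩ := exists_sequence_of_card_lt S
    (fun g => Finset.univ.filter fun h => ¬ overlap (U g) h ≤ D * r / 2) (by positivity)
    (fun g => card_overlap_gt_le (hU g) (hs g) hrD) M (by
      refine lt_of_lt_of_le ?_ hS
      have h2 : (2 : ℝ) < Real.exp (D * r / 32) := by
        have := Real.add_one_lt_exp (x := (D * r / 32 : ℝ)) (by positivity)
        linarith
      calc (M : ℝ) * (2 ^ (D * r) * Real.exp (-(D * r / 16))) ≤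
            Real.exp (D * r / 32) * (2 ^ (D * r) * Real.exp (-(D * r / 16))) := by gcongr
        _ = 2 ^ (D * r) / Real.exp (D * r / 32) := by
            have e : (D * r / 32 : ℝ) + -(D * r / 16) + D * r / 32 = 0 := by ring
            rw [mul_left_comm, ← Real.exp_add, eq_div_iff (Real.exp_pos _).ne', mul_assoc,
              ← Real.exp_add, e, Real.exp_zero, mul_one]
        _ < _ := by gcongr)
  have := log_le_of_separated hD hr hM F hF hδ0 hδ1 hδB hη0 hη1 (by rw [hηδ]; linarith) hs hU hUg f
    (fun i j hij => by simpa using hsep i j hij) (fun i => (Finset.mem_filter.1 (hf i)).2)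
  calc _ ≤ 144 * (η ^ 2 / r) * N := this.trans_eq (by simp only [X]; ring)
    _ ≤ 144 * (1600 * ε ^ 2 / B) * N := by gcongr
    _ = _ := by ring

/-- The bound for two features in a fixed dimension. -/
lemma log_two_le_of_allowsPrediction (hD : 2 ≤ D) (hD64 : D ≤ 64) (F : ∀ k, POVM D (l k))
    (hF : AllowsPrediction F 2 B ε (2 / 3)) (hε : 0 < ε) (hε6 : ε ≤ 1 / 6)
    (hB : 36 * ε ^ 2 ≤ B) (hBD : B ≤ D) :
    Real.log 2 ≤ 2 ^ 64 * (115200 * ε ^ 2 / B) * N := by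
  have hD0 : 0 < D := by omega
  have hD2 : (2 : ℝ) ≤ D := by exact_mod_cast hD
  have hD64' : (D : ℝ) ≤ 64 := by exact_mod_cast hD64
  obtain ⟨δ, η, hδ0, hδ1, hδB, hη0, hη1, hηδ, hη⟩ :=
    exists_scaling (r := 1) one_pos hε hε6 (by simpa using hB) (by push_cast; linarith)
  choose s hs U hU hUg using fun g : Fin D × Fin 1 → ℤˣ => exists_orthonormal_columns (signMatrix g)
  -- The mean overlap with the all-plus column is at most `1 ≤ D / 2`.
  obtain ⟨g, hg⟩ : ∃ g : Fin D × Fin 1 → ℤˣ, overlap (U 1) g ≤ D * (1 : ℕ) / 2 := by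
    by_contra! h
    have h1 := Finset.sum_lt_sum_of_nonempty (s := Finset.univ) Finset.univ_nonempty fun g _ => h g
    rw [sum_overlap (hU 1)] at h1
    simp at h1
    have : (s 1 : ℝ) ≤ 1 := by exact_mod_cast hs 1
    linarith
  have hX : ∀ g : Fin D × Fin 1 → ℤˣ,
      ∑ k, chiSq (F k) (toComplex (signState η g)) (mixedState D) ≤
        2 ^ 64 * (N * (2 * η ^ 2 / (1 : ℕ))) := by
    intro g
    -- In bounded dimension a single divergence may be bounded by the sum over all `2 ^ D ≤ 2 ^ 64`
    -- sign vectors.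
    refine (Finset.single_le_sum (f := fun g =>
      ∑ k, chiSq (F k) (toComplex (signState η g)) (mixedState D))
      (fun g _ => sum_chiSq_nonneg hD0 F _) (Finset.mem_univ g)).trans
      ((sum_sum_chiSq_le hD0 one_pos F η).trans ?_)
    gcongr
    · norm_num
    · omega
  have := log_le_of_separated hD0 one_pos le_rfl F hF hδ0 hδ1 hδB hη0 hη1 (by rw [hηδ]; linarith)
    hs hU hUg ![1, g] (fun i j hij => by
      fin_cases i <;> fin_cases j <;> simp at hij
      simpa using hg) (fun i => hX _)
  calc Real.log 2 ≤ 2 ^ 64 * (72 * (η ^ 2 / (1 : ℕ))) * N := by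
        refine le_trans (by exact_mod_cast this) (le_of_eq ?_)
        ring
    _ ≤ 2 ^ 64 * (72 * (1600 * ε ^ 2 / B)) * N := by gcongr
    _ = _ := by ring

lemma half_le_log_floor_exp {x : ℝ} (hx : 2 ≤ x) : x / 2 ≤ Real.log ⌊Real.exp x⌋₊ := by
  have h1 : Real.exp (x / 2) * Real.exp (x / 2) = Real.exp x := by
    rw [← Real.exp_add]; ring_nf
  have h2 : 2 ≤ Real.exp (x / 2) := by
    have := Real.add_one_le_exp (x / 2)
    linarith
  have h3 : Real.exp (x / 2) ≤ ⌊Real.exp x⌋₊ := by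
    have := Nat.lt_floor_add_one (Real.exp x)
    nlinarith
  exact (Real.le_log_iff_exp_le (by linarith)).2 h3

lemma lower_bound_of_large_dim (hD : 64 ≤ D) (hM : 2 ≤ M) (F : ∀ k, POVM D (l k))
    (hε : 0 < ε) (hε6 : ε ≤ 1 / 6) (hB : 36 * ε ^ 2 ≤ B) (hBD : B ≤ D)
    (hF : AllowsPrediction F M B ε (2 / 3)) :
    B / ε ^ 2 * min (Real.log M) (min (B * D / ε ^ 2) (D ^ 2)) ≤ 230400 * 4608 * N := by
  have hD' : (64 : ℝ) ≤ D := by exact_mod_cast hD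
  have hB0 : 0 < B := lt_of_lt_of_le (by positivity) hB
  -- The two entries encode `8 r ≤ D` and `36 ε² r ≤ B`; the latter leaves room for `η ≤ 1`.
  set m : ℝ := min (D / 8) (B / (36 * ε ^ 2)) with hm
  have hm1 : 1 ≤ m := le_min (by linarith) (by rw [le_div_iff₀ (by positivity)]; linarith)
  set r := ⌊m⌋₊
  have hr : 0 < r := Nat.floor_pos.2 hm1
  have hr' : (1 : ℝ) ≤ r := by exact_mod_cast hr
  have hrm : (r : ℝ) ≤ m := Nat.floor_le (by linarith)
  have hmr : m / 2 ≤ r := by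
    have := Nat.lt_floor_add_one m
    linarith
  have hr8 : 8 * (r : ℝ) ≤ D := by
    have := hrm.trans (min_le_left _ _)
    linarith
  have hrB : 36 * ε ^ 2 * r ≤ B := by
    have := hrm.trans (min_le_right _ _)
    rw [le_div_iff₀ (by positivity)] at this
    linarith
  have hBr : B ≤ 64 * r := by
    have h1 : B / 8 ≤ m := by
      refine le_min (by linarith) ?_
      rw [div_le_div_iff₀ (by norm_num) (by positivity)]
      have : 36 * ε ^ 2 ≤ 1 := by nlinarith
      nlinarith
    linarith
  have hDr : (64 : ℝ) ≤ D * r := by nlinarith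
  set K := ⌊Real.exp (D * r / 32)⌋₊
  have hK := half_le_log_floor_exp (x := D * r / 32) (by linarith)
  have hK2 : 2 ≤ K := by
    refine Nat.le_floor ?_
    have := Real.add_one_le_exp (D * r / 32 : ℝ)
    push_cast
    linarith
  have key := log_le_of_allowsPrediction (M := min M K) hr (by exact_mod_cast hr8)
    (by exact_mod_cast hDr) (le_min hM hK2)
    (le_trans (Nat.cast_le.2 (min_le_right M K)) (Nat.floor_le (Real.exp_pos _).le)) F
    (hF.mono_left hB0.le (min_le_left _ _)) hε hε6 hrB hBr
  have hlog : min (Real.log M) (min (B * D / ε ^ 2) (D ^ 2)) / 4608 ≤ Real.log (min M K : ℕ) := by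
    have hlogM : 0 ≤ Real.log M := Real.log_natCast_nonneg _
    rcases min_choice M K with h | h <;> rw [h]
    · have := min_le_left (Real.log M) (min (B * D / ε ^ 2) ((D : ℝ) ^ 2))
      linarith
    · have h1 : min (B * D / ε ^ 2) ((D : ℝ) ^ 2) / 4608 ≤ D * (m / 2) / 64 := by
        rw [hm]
        rcases min_choice ((D : ℝ) / 8) (B / (36 * ε ^ 2)) with h | h <;> rw [h]
        · have := min_le_right (B * D / ε ^ 2) ((D : ℝ) ^ 2)
          nlinarith
        · have := min_le_left (B * D / ε ^ 2) ((D : ℝ) ^ 2)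
          calc _ ≤ (B * D / ε ^ 2) / 4608 := by gcongr
            _ = _ := by field_simp; norm_num
      have h2 : (D : ℝ) * (m / 2) / 64 ≤ D * r / 64 := by gcongr
      have h3 := min_le_right (Real.log M) (min (B * D / ε ^ 2) ((D : ℝ) ^ 2))
      calc _ ≤ min (B * D / ε ^ 2) ((D : ℝ) ^ 2) / 4608 := by gcongr
        _ ≤ _ := h1
        _ ≤ _ := h2
        _ = D * r / 32 / 2 := by ring
        _ ≤ _ := hK
  have h5 := hlog.trans key
  calc _ = B / ε ^ 2 * (min (Real.log M) (min (B * D / ε ^ 2) (D ^ 2)) / 4608) * 4608 := by ring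
    _ ≤ B / ε ^ 2 * (230400 * ε ^ 2 / B * N) * 4608 := by gcongr
    _ = _ := by field_simp

end LowerBound

theorem theorem2 :
    ∃ c : ℝ, 0 < c ∧
      ∀ (D M N : ℕ) (B ε : ℝ) (l : Fin N → ℕ) (F : ∀ k : Fin N, POVM D (l k)),
        2 ≤ D → 0 < ε → ε ≤ 1 / 6 → 36 * ε ^ 2 ≤ B → B ≤ D →
        AllowsPrediction F M B ε (2 / 3) →
        c * min (B * Real.log M / ε ^ 2) (min (B ^ 2 * D / ε ^ 4) (B * D ^ 2 / ε ^ 2)) ≤ N := by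
  -- The case `D < 64` dictates the constant: `230400 · 64² ≤ 10 ^ 9`.
  refine ⟨1 / (2 ^ 64 * 10 ^ 9), by positivity, fun D M N B ε l F hD hε hε6 hB hBD hF => ?_⟩
  have hB0 : 0 < B := lt_of_lt_of_le (by positivity) hB
  rw [div_mul_eq_mul_div, one_mul, div_le_iff₀ (by positivity)]
  have hN : (0 : ℝ) ≤ N := Nat.cast_nonneg _
  rcases Nat.lt_or_ge M 2 with hM | hM
  · have hlog : Real.log M = 0 := by
      interval_cases M <;> simp
    refine (min_le_left _ _).trans ?_
    rw [hlog]
    simp only [mul_zero, zero_div]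
    positivity
  rcases Nat.lt_or_ge D 64 with hD64 | hD64
  · have h1 := log_two_le_of_allowsPrediction hD hD64.le F (hF.mono_left hB0.le hM) hε hε6 hB hBD
    have hlog2 : (1 / 2 : ℝ) ≤ Real.log 2 := by linarith [Real.log_two_gt_d9]
    have h2 : B / ε ^ 2 ≤ 2 ^ 64 * 230400 * N := by
      have : B / ε ^ 2 * (1 / 2) ≤ B / ε ^ 2 * (2 ^ 64 * (115200 * ε ^ 2 / B) * N) := by
        gcongr
        exact hlog2.trans h1
      have e : B / ε ^ 2 * (2 ^ 64 * (115200 * ε ^ 2 / B) * N) = 2 ^ 64 * 115200 * N := by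
        field_simp
      rw [e] at this
      linarith
    have hD' : (D : ℝ) ^ 2 ≤ 64 ^ 2 := by
      gcongr
      exact_mod_cast hD64.le
    calc _ ≤ B * (D : ℝ) ^ 2 / ε ^ 2 := (min_le_right _ _).trans (min_le_right _ _)
      _ = B / ε ^ 2 * D ^ 2 := by ring
      _ ≤ 2 ^ 64 * 230400 * N * 64 ^ 2 := by gcongr
      _ = (2 ^ 64 * 230400 * 64 ^ 2) * N := mul_right_comm _ _ _
      _ ≤ (2 ^ 64 * 10 ^ 9) * N := mul_le_mul_of_nonneg_right (by norm_num) hN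
      _ = _ := mul_comm _ _
  · have h1 := lower_bound_of_large_dim hD64 hM F hε hε6 hB hBD hF
    have e : min (B * Real.log M / ε ^ 2) (min (B ^ 2 * D / ε ^ 4) (B * D ^ 2 / ε ^ 2)) =
        B / ε ^ 2 * min (Real.log M) (min (B * D / ε ^ 2) (D ^ 2)) := by
      rw [mul_min_of_nonneg _ _ (by positivity), mul_min_of_nonneg _ _ (by positivity)]
      congr 1
      · ring
      · congr 1
        · field_simp
        · ring
    rw [e]
    refine h1.trans ?_
    rw [mul_comm (N : ℝ)]
    exact mul_le_mul_of_nonneg_right (by norm_num) hN
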